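/- Let $x,t$ be real coordinates and let $\beta=\beta(t,x)$ be an arbitrary smooth real function on an open set $\Omega\subseteq\mathbb R^2$ with $\partial\beta/\partial x\ne 0$ at every point of $\Omega$. Consider the evolution equation $$u_t = F := \beta_x u^2 u_{xx} + 2\beta_{xx}u^2u_x + 4\beta u_x + (\beta_{xxx}-4\beta_x)u^3 - 4\beta_x u ,$$ and the matrices $$A=\begin{pmatrix} \frac1u & 1\\ 1& -\frac1u\end{pmatrix},\qquad B=\begin{pmatrix} -\beta_x u_x+\frac{4\beta}{u}-\beta_{xx}u & 4\beta+2\beta_x u\\ 4\beta-2\beta_x u & \beta_x u_x-\frac{4\beta}{u}+\beta_{xx}u\end{pmatrix}.$$ Let $E=\mathbb R^\infty$ be the space with coordinates $t,x,u=u_0,u_1=u_x,u_2=u_{xx},\dots$, with the product topology, whose smooth functions are those depending smoothly, locally, on finitely many coordinates, and let $$D_x=\partial_x+\sum_{k\ge0}u_{k+1}\,\partial_{u_k},\qquad D_t=\partial_t+\sum_{k\ge0}(D_x^kF)\,\partial_{u_k}.$$ Let $\mathbb K$ be $\mathbb R$ or $\mathbb C$. For a Lie algebra $\mathfrak g\subseteq\mathfrak{sl}_2(\mathbb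 K)$, a $\mathfrak g$-valued zero-curvature representation (ZCR) on an open set $U\subseteq E$ is a form $\alpha=A'\,dx+B'\,dt$ with smooth $\mathfrak g$-valued $A',B'$ on $U$ such that $D_tA'-D_xB'+[A',B']=0$ on $U$. Two forms are gauge equivalent on $U$ if one is obtained from the other as $\alpha\mapsto dS\,S^{-1}+S\alpha S^{-1}$, $dS=D_xS\,dx+D_tS\,dt$, for a smooth function $S:U\to SL_2(\mathbb K)$. An $\mathfrak{sl}_2$-valued ZCR on $U$ is reducible on $U$ if it is gauge equivalent on $U$ to a ZCR with values in a proper Lie subalgebra of $\mathfrak{sl}_2(\mathbb K)$, and irreducible otherwise. Then, on every non-empty open set $U\subseteq E$ contained in the region $\{(t,x)\in\Omega,\ u\neq0\}$ (in particular on the whole region, if $\Omega\ne\emptyset$), $A\,dx+B\,dt$ is an irreducible $\mathfrak{sl}_2(\mathbb K)$-valued ZCR of the equation. In particular, it is not gauge equivalent on $U$ to any form $A'\,dx+B'\,dt$ in which $A'$ and $B'$ are lower triangular, whatever the diagonal entries. -/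

import Mathlib

open scoped ContDiff MatrixGroups

noncomputable section

namespace ZeroCurvature

/-- The infinite-dimensional space with coordinates `t`, `x` and `u_k` for `k = 0, 1, 2, …`
(`u_0 = u`, `u_1 = u_x`, `u_2 = u_xx`, …), with the product topology. It is the equation manifold
of any scalar evolution equation. -/
abbrev Jet : Type := ℝ × ℝ × (ℕ → ℝ)

namespace Jet

/-- The coordinate `t`. -/
def t (θ : Jet) : ℝ := θ.1

/-- The coordinate `x`. -/
def x (θ : Jet) : ℝ := θ.2.1

/-- The coordinate `u_k`. -/
def u (θ : Jet) (k : ℕ) : ℝ := θ.2.2 k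

/-- Projection onto the coordinates `t, x, u_0, …, u_{n-1}`. -/
def trunc (n : ℕ) (θ : Jet) : ℝ × ℝ × (Fin n → ℝ) := (θ.t, θ.x, fun i => θ.u i)

end Jet

section Functions

variable {V : Type*} [NormedAddCommGroup V] [NormedSpace ℝ V]

/-- Smooth functions on jet space: near every point of `U`, the function is a smooth function
of finitely many of the coordinates. -/
def SmoothOn (f : Jet → V) (U : Set Jet) : Prop :=
  ∀ θ ∈ U, ∃ (n : ℕ) (W : Set (ℝ × ℝ × (Fin n → ℝ))) (g : ℝ × ℝ × (Fin n → ℝ) → V),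
    IsOpen W ∧ θ.trunc n ∈ W ∧ ContDiffOn ℝ ∞ g W ∧
      ∀ η : Jet, η.trunc n ∈ W → f η = g (η.trunc n)

/-- `∂f/∂t`. -/
def partialT (f : Jet → V) (θ : Jet) : V := deriv (fun s : ℝ => f (s, θ.x, θ.u)) θ.t

/-- `∂f/∂x`. -/
def partialX (f : Jet → V) (θ : Jet) : V := deriv (fun s : ℝ => f (θ.t, s, θ.u)) θ.x

/-- `∂f/∂u_k`. -/
def partialU (k : ℕ) (f : Jet → V) (θ : Jet) : V :=
  deriv (fun s : ℝ => f (θ.t, θ.x, Function.update θ.u k s)) (θ.u k)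

/-- The total derivative `D_x = ∂/∂x + ∑_k u_{k+1} ∂/∂u_k`. The sum is finite on smooth functions,
since these depend locally on finitely many coordinates. -/
def totalX (f : Jet → V) (θ : Jet) : V :=
  partialX f θ + ∑ᶠ k : ℕ, θ.u (k + 1) • partialU k f θ

/-- The total derivative `D_t = ∂/∂t + ∑_k (D_x^k F) ∂/∂u_k` along the evolution equation
`u_t = F`. -/
def totalT (F : Jet → ℝ) (f : Jet → V) (θ : Jet) : V :=
  partialT f θ + ∑ᶠ k : ℕ, (totalX^[k] F) θ • partialU k f θ

end Functions

section Representations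

variable {𝕜 : Type*} [RCLike 𝕜]

attribute [local instance] LieRing.ofAssociativeRing

/-- Entrywise smoothness of a matrix-valued function. -/
def MatrixSmoothOn (M : Jet → Matrix (Fin 2) (Fin 2) 𝕜) (U : Set Jet) : Prop :=
  ∀ i j, SmoothOn (fun θ => M θ i j) U

/-- `D_x` acting entrywise on matrix-valued functions. -/
def matrixTotalX (M : Jet → Matrix (Fin 2) (Fin 2) 𝕜) (θ : Jet) : Matrix (Fin 2) (Fin 2) 𝕜 :=
  Matrix.of fun i j => totalX (fun η => M η i j) θ

/-- `D_t` acting entrywise on matrix-valued functions. -/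
def matrixTotalT (F : Jet → ℝ) (M : Jet → Matrix (Fin 2) (Fin 2) 𝕜) (θ : Jet) :
    Matrix (Fin 2) (Fin 2) 𝕜 :=
  Matrix.of fun i j => totalT F (fun η => M η i j) θ

/-- `A dx + B dt` is a `𝔤`-valued zero-curvature representation, on the subset `U` of jet space,
of the evolution equation `u_t = F`. -/
structure IsZCROn (𝔤 : LieSubalgebra 𝕜 (Matrix (Fin 2) (Fin 2) 𝕜)) (F : Jet → ℝ) (U : Set Jet)
    (A B : Jet → Matrix (Fin 2) (Fin 2) 𝕜) : Prop where
  smooth_A : MatrixSmoothOn A U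
  smooth_B : MatrixSmoothOn B U
  mem_A : ∀ θ ∈ U, A θ ∈ 𝔤
  mem_B : ∀ θ ∈ U, B θ ∈ 𝔤
  zero_curvature : ∀ θ ∈ U,
    matrixTotalT F A θ - matrixTotalX B θ + (A θ * B θ - B θ * A θ) = 0

/-- `A' dx + B' dt` is obtained from `α = A dx + B dt`, over `U`, by a gauge transformation
`α ↦ dS S⁻¹ + S α S⁻¹` with a smooth `SL₂`-valued function `S`; here `dS = D_x S dx + D_t S dt`. -/
def GaugeEquivOn (F : Jet → ℝ) (U : Set Jet) (A B A' B' : Jet → Matrix (Fin 2) (Fin 2) 𝕜) : Prop :=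
  ∃ S : Jet → SL(2, 𝕜),
    MatrixSmoothOn (fun θ => (S θ : Matrix (Fin 2) (Fin 2) 𝕜)) U ∧
    ∀ θ ∈ U,
      A' θ = matrixTotalX (fun η => (S η : Matrix (Fin 2) (Fin 2) 𝕜)) θ * (((S θ)⁻¹ : SL(2, 𝕜)) :
          Matrix (Fin 2) (Fin 2) 𝕜) +
        (S θ : Matrix (Fin 2) (Fin 2) 𝕜) * A θ * (((S θ)⁻¹ : SL(2, 𝕜)) :
          Matrix (Fin 2) (Fin 2) 𝕜) ∧
      B' θ = matrixTotalT F (fun η => (S η : Matrix (Fin 2) (Fin 2) 𝕜)) θ *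
          (((S θ)⁻¹ : SL(2, 𝕜)) : Matrix (Fin 2) (Fin 2) 𝕜) +
        (S θ : Matrix (Fin 2) (Fin 2) 𝕜) * B θ * (((S θ)⁻¹ : SL(2, 𝕜)) :
          Matrix (Fin 2) (Fin 2) 𝕜)

/-- The Lie algebra `sl₂` of traceless matrices. -/
abbrev sl₂ (𝕜 : Type*) [RCLike 𝕜] : LieSubalgebra 𝕜 (Matrix (Fin 2) (Fin 2) 𝕜) :=
  LieAlgebra.SpecialLinear.sl (Fin 2) 𝕜

/-- The `sl₂`-valued form `A dx + B dt` is reducible over `U`: it is gauge equivalent to a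
zero-curvature representation with values in a proper subalgebra of `sl₂`. -/
def ReducibleOn (F : Jet → ℝ) (U : Set Jet) (A B : Jet → Matrix (Fin 2) (Fin 2) 𝕜) : Prop :=
  ∃ 𝔥 : LieSubalgebra 𝕜 (Matrix (Fin 2) (Fin 2) 𝕜), 𝔥 < sl₂ 𝕜 ∧
    ∃ A' B' : Jet → Matrix (Fin 2) (Fin 2) 𝕜,
      IsZCROn 𝔥 F U A' B' ∧ GaugeEquivOn F U A B A' B'

/-- `A dx + B dt` is an irreducible `sl₂`-valued zero-curvature representation over `U`. -/
def IrreducibleZCROn (F : Jet → ℝ) (U : Set Jet) (A B : Jet → Matrix (Fin 2) (Fin 2) 𝕜) : Prop :=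
  IsZCROn (sl₂ 𝕜) F U A B ∧ ¬ ReducibleOn F U A B

/-- The upper right entries of `A` and `B` vanish over `U`. -/
def LowerTriangularOn (U : Set Jet) (A B : Jet → Matrix (Fin 2) (Fin 2) 𝕜) : Prop :=
  ∀ θ ∈ U, A θ 0 1 = 0 ∧ B θ 0 1 = 0

end Representations

section TheClass

/-- The `k`-th derivative `∂^k β/∂x^k` as a function on jet space; `β` takes the arguments
`t, x`. -/
def derivX (k : ℕ) (β : ℝ → ℝ → ℝ) (θ : Jet) : ℝ := iteratedDeriv k (β θ.t) θ.x

/-- The right-hand side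
`β_x u² u_xx + 2 β_xx u² u_x + 4 β u_x + (β_xxx - 4 β_x) u³ - 4 β_x u`. -/
def evolutionRHS (β : ℝ → ℝ → ℝ) (θ : Jet) : ℝ :=
  derivX 1 β θ * θ.u 0 ^ 2 * θ.u 2 + 2 * derivX 2 β θ * θ.u 0 ^ 2 * θ.u 1
    + 4 * β θ.t θ.x * θ.u 1 + (derivX 3 β θ - 4 * derivX 1 β θ) * θ.u 0 ^ 3
    - 4 * derivX 1 β θ * θ.u 0

/-- The matrix `A` of the representation. -/
def matrixA (𝕜 : Type*) [RCLike 𝕜] (θ : Jet) : Matrix (Fin 2) (Fin 2) 𝕜 :=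
  Matrix.map !![1 / θ.u 0, 1; 1, -(1 / θ.u 0)] (fun r : ℝ => (r : 𝕜))

/-- The diagonal entry `-β_x u_x + 4 β / u - β_xx u` of `B`. -/
def entryB (β : ℝ → ℝ → ℝ) (θ : Jet) : ℝ :=
  -derivX 1 β θ * θ.u 1 + 4 * (β θ.t θ.x / θ.u 0) - derivX 2 β θ * θ.u 0

/-- The matrix `B` of the representation. -/
def matrixB (𝕜 : Type*) [RCLike 𝕜] (β : ℝ → ℝ → ℝ) (θ : Jet) : Matrix (Fin 2) (Fin 2) 𝕜 :=
  Matrix.map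
    !![entryB β θ, 4 * β θ.t θ.x + 2 * derivX 1 β θ * θ.u 0;
       4 * β θ.t θ.x - 2 * derivX 1 β θ * θ.u 0, -entryB β θ] (fun r : ℝ => (r : 𝕜))

/-- The part of jet space over `Ω` on which `u ≠ 0`. -/
def regularRegion (Ω : Set (ℝ × ℝ)) : Set Jet := {θ | (θ.t, θ.x) ∈ Ω ∧ θ.u 0 ≠ 0}

end TheClass

end ZeroCurvature

end

/-! The zero-curvature identity is an entrywise computation; its diagonal entry carries the
equation, while the off-diagonal ones do not involve the right-hand side.

For irreducibility, a proper subalgebra of `sl₂` stabilizes, under `ad`, a line spanned by some `N ≠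
0` in `sl₂` (`exists_stable_line`). A gauge transformation `S` into that subalgebra turns `N` into
`Q = S⁻¹NS`, and the x-part of the gauge relation gives `D_x Q = [A, Q] + a Q` with a scalar
function `a` (`adjugate_conj_derivative`). In the coordinates `11, 12, 21`, `ad A` is `L + u⁻¹
diag(0, 2, -2)` with `L` constant.

Such a `Q` must vanish (`eq_zero_of_projective_solution`). Where a coordinate of `Q` is nonzero, the
ratios `ρ` of the coordinates satisfy `D_x ρ = G(u, ρ)`, which no longer contains `a`. As `ρ`
depends on finitely many `u_k`, comparing the highest ones downwards shows that it depends on none,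
and then that `∂G/∂u = 0` along it (`fderiv_eq_zero_of_totalX_eq`). Hence `ρ` is an eigenvector of
the diagonal part, that is, a basis vector. It is therefore constant, so it is an eigenvector of `L`
as well; but no basis vector is one.

The same obstruction excludes lower triangular forms, since these stabilize the line of `E₂₁`. -/

noncomputable section

namespace ZeroCurvature

/-! ### Functions of finitely many jet coordinates with `D_x ρ = G(u, ρ)` -/

section Prolongation

variable {V : Type*} [NormedAddCommGroup V] [NormedSpace ℝ V]

/-- The shift `(u_0, …, u_m) ↦ (u_1, …, u_m, 0)`. -/
def shiftCLM (m : ℕ) : (Fin (m + 1) → ℝ) →L[ℝ] (Fin (m + 1) → ℝ) :=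
  ContinuousLinearMap.pi fun i =>
    if h : (i : ℕ) + 1 < m + 1 then ContinuousLinearMap.proj ⟨i + 1, h⟩ else 0

theorem shiftCLM_apply (m : ℕ) (a : Fin (m + 1) → ℝ) (i : Fin (m + 1)) :
    shiftCLM m a i = if h : (i : ℕ) + 1 < m + 1 then a ⟨i + 1, h⟩ else 0 := by
  by_cases h : (i : ℕ) + 1 < m + 1
  · simp only [shiftCLM, ContinuousLinearMap.coe_pi', dif_pos h, ContinuousLinearMap.proj_apply]
  · simp only [shiftCLM, ContinuousLinearMap.coe_pi', dif_neg h, zero_apply]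

theorem shiftCLM_single_zero (m : ℕ) : shiftCLM m (Pi.single 0 1) = 0 := by
  ext i
  rw [shiftCLM_apply]
  split_ifs with h
  · rw [Pi.single_eq_of_ne (Fin.ne_of_val_ne (Nat.succ_ne_zero _))]; rfl
  · rfl

theorem shiftCLM_single_succ (m k : ℕ) (hk : k + 1 < m + 1) :
    shiftCLM m (Pi.single ⟨k + 1, hk⟩ 1) = Pi.single ⟨k, by omega⟩ 1 := by
  ext i
  rw [shiftCLM_apply]
  split_ifs with h
  · simp [Pi.single_apply, Fin.ext_iff]
  · rw [Pi.single_eq_of_ne]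
    rw [Ne, Fin.ext_iff]
    intro h'
    simp only at h'
    omega

/-- The jet with prescribed coordinates `t, x, u_0, …, u_m`, all others being equal to `c`. -/
def extendJet {m : ℕ} (c : ℝ) (y : ℝ × ℝ × (Fin (m + 1) → ℝ)) : Jet :=
  (y.1, y.2.1, fun k => if h : k < m + 1 then y.2.2 ⟨k, h⟩ else c)

theorem trunc_extendJet {m : ℕ} (c : ℝ) (y : ℝ × ℝ × (Fin (m + 1) → ℝ)) :
    (extendJet c y).trunc (m + 1) = y := by
  refine Prod.ext rfl (Prod.ext rfl ?_)
  funext i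
  simp only [extendJet, Jet.trunc, Jet.u, dif_pos i.isLt, Fin.eta]

theorem extendJet_u_zero {m : ℕ} (c : ℝ) (y : ℝ × ℝ × (Fin (m + 1) → ℝ)) :
    (extendJet c y).u 0 = y.2.2 0 := by
  simp [extendJet, Jet.u]

/-- The coordinate `u_{m+1}` enters only the last slot. It is invisible to the truncation, so `c`
can be varied freely with the truncated jet fixed. -/
theorem extendJet_shift {m : ℕ} (c : ℝ) (y : ℝ × ℝ × (Fin (m + 1) → ℝ)) :
    (fun i : Fin (m + 1) => (extendJet c y).u (i + 1)) =
      shiftCLM m y.2.2 + Pi.single (Fin.last m) c := by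
  funext i
  rw [Pi.add_apply, shiftCLM_apply]
  simp only [extendJet, Jet.u]
  by_cases h : (i : ℕ) + 1 < m + 1
  · rw [dif_pos h, dif_pos h, Pi.single_eq_of_ne, add_zero]
    rw [Ne, Fin.ext_iff, Fin.val_last]
    omega
  · have : i = Fin.last m := by
      rw [Fin.ext_iff, Fin.val_last]
      omega
    rw [dif_neg h, dif_neg h, this, Pi.single_eq_same, zero_add]

/-- This is the commutator `[∂_a, D_x] = ∂_{shift a}`, the analogue of `[∂_{u_{k+1}}, D_x] =
∂_{u_k}`, applied to `ρ`. Differentiating the equation along `a` leaves only this term on the left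
when `∂_a ρ` vanishes identically, and only `a 0 · ∂G/∂u` on the right. -/
theorem fderiv_shift_of_fderiv_eq_zero {m : ℕ} {W : Set (ℝ × ℝ × (Fin (m + 1) → ℝ))}
    (hW : IsOpen W) {ρ : ℝ × ℝ × (Fin (m + 1) → ℝ) → V} (hρ : ContDiffOn ℝ ∞ ρ W)
    {G : ℝ × V → V} (hG : ∀ y ∈ W, DifferentiableAt ℝ G (y.2.2 0, ρ y))
    (h : ∀ y ∈ W, fderiv ℝ ρ y (0, 1, shiftCLM m y.2.2) = G (y.2.2 0, ρ y))
    (a : Fin (m + 1) → ℝ) (ha : ∀ y ∈ W, fderiv ℝ ρ y (0, 0, a) = 0) :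
    ∀ y ∈ W, fderiv ℝ ρ y (0, 0, shiftCLM m a) = fderiv ℝ G (y.2.2 0, ρ y) (a 0, 0) := by
  intro y hy
  have hWy : W ∈ nhds y := hW.mem_nhds hy
  have hcd : ContDiffAt ℝ ∞ ρ y := hρ.contDiffAt hWy
  have hd : DifferentiableAt ℝ ρ y := hcd.differentiableAt (by simp)
  have hdd : DifferentiableAt ℝ (fderiv ℝ ρ) y :=
    (hcd.fderiv_right (m := 1) (WithTop.coe_le_coe.2 le_top)).differentiableAt (by simp)
  have hsymm : IsSymmSndFDerivAt ℝ ρ y :=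
    hcd.isSymmSndFDerivAt (by simp only [minSmoothness_of_isRCLikeNormedField]; exact WithTop.coe_le_coe.2 le_top)
  let P : (ℝ × ℝ × (Fin (m + 1) → ℝ)) →L[ℝ] (Fin (m + 1) → ℝ) :=
    (ContinuousLinearMap.snd ℝ ℝ _).comp (ContinuousLinearMap.snd ℝ ℝ _)
  have hv : HasFDerivAt (fun z : ℝ × ℝ × (Fin (m + 1) → ℝ) => ((0 : ℝ), (1 : ℝ), shiftCLM m z.2.2))
      ((0 : _ →L[ℝ] ℝ).prod ((0 : _ →L[ℝ] ℝ).prod ((shiftCLM m).comp P))) y :=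
    (hasFDerivAt_const _ _).prodMk ((hasFDerivAt_const _ _).prodMk ((shiftCLM m).comp P).hasFDerivAt)
  have h1 := hdd.hasFDerivAt.clm_apply hv
  have h2 : HasFDerivAt (fun z => G (z.2.2 0, ρ z)) _ y :=
    (hG y hy).hasFDerivAt.comp y
      ((((ContinuousLinearMap.proj (R := ℝ) (φ := fun _ : Fin (m + 1) => ℝ) 0).comp P).hasFDerivAt
        (x := y)).prodMk hd.hasFDerivAt)
  have h3 := h2.congr_of_eventuallyEq (Filter.eventuallyEq_of_mem hWy h)
  have h4 := congrArg (fun L => L ((0 : ℝ), (0 : ℝ), a)) (h1.unique h3)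
  -- The mixed second derivative vanishes because `∂_a ρ = 0` on the whole open set; symmetry then
  -- removes it from `h4`.
  have h5 : fderiv ℝ (fderiv ℝ ρ) y (0, 1, shiftCLM m y.2.2) (0, 0, a) = 0 := by
    have h6 := hdd.hasFDerivAt.clm_apply (hasFDerivAt_const ((0 : ℝ), (0 : ℝ), a) y)
    have h7 := (hasFDerivAt_const (𝕜 := ℝ) (0 : V) y).congr_of_eventuallyEq
      (Filter.eventuallyEq_of_mem hWy ha)
    have h8 := congrArg (fun L => L ((0 : ℝ), (1 : ℝ), shiftCLM m y.2.2)) (h6.unique h7)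
    simpa using h8
  rw [hsymm] at h5
  simpa [P, h5, ha y hy] using h4

/-- A function of finitely many jet coordinates satisfying `D_x ρ = G(u, ρ)` depends on none of the
coordinates `u_k`, and `∂G/∂u` vanishes along it. -/
theorem fderiv_eq_zero_of_totalX_eq {m : ℕ} {W : Set (ℝ × ℝ × (Fin (m + 1) → ℝ))}
    (hW : IsOpen W) {ρ : ℝ × ℝ × (Fin (m + 1) → ℝ) → V} (hρ : ContDiffOn ℝ ∞ ρ W)
    {G : ℝ × V → V} (hG : ∀ y ∈ W, DifferentiableAt ℝ G (y.2.2 0, ρ y))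
    (h : ∀ θ : Jet, θ.trunc (m + 1) ∈ W →
      fderiv ℝ ρ (θ.trunc (m + 1)) (0, 1, fun i => θ.u (i + 1)) =
        G (θ.u 0, ρ (θ.trunc (m + 1)))) :
    ∀ y ∈ W, fderiv ℝ G (y.2.2 0, ρ y) (1, 0) = 0 := by
  have hc : ∀ (c : ℝ), ∀ y ∈ W,
      fderiv ℝ ρ y (0, 1, shiftCLM m y.2.2 + Pi.single (Fin.last m) c) = G (y.2.2 0, ρ y) := by
    intro c y hy
    have := h (extendJet c y) (by rwa [trunc_extendJet])
    rwa [trunc_extendJet, extendJet_shift, extendJet_u_zero] at this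
  have h0 : ∀ y ∈ W, fderiv ℝ ρ y (0, 1, shiftCLM m y.2.2) = G (y.2.2 0, ρ y) := by
    intro y hy
    simpa using hc 0 y hy
  -- Descending induction on `k`, with `j` bounding the distance to the top index `m`. At the top,
  -- `∂ρ/∂u_m` is the coefficient of `u_{m+1}` in `D_x ρ`, read off by comparing `c = 1` with `c =
  -- 0`.
  have key : ∀ j k : ℕ, (hk : k < m + 1) → m ≤ k + j → ∀ y ∈ W,
      fderiv ℝ ρ y (0, 0, Pi.single ⟨k, hk⟩ 1) = 0 := by
    intro j
    induction j with
    | zero =>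
      intro k hk hkm y hy
      have hlast : (⟨k, hk⟩ : Fin (m + 1)) = Fin.last m := by
        rw [Fin.ext_iff, Fin.val_last]; simp only; omega
      rw [hlast]
      have e : ((0 : ℝ), (0 : ℝ), (Pi.single (Fin.last m) 1 : Fin (m + 1) → ℝ)) =
          (0, 1, shiftCLM m y.2.2 + Pi.single (Fin.last m) 1) - (0, 1, shiftCLM m y.2.2) := by
        simp
      rw [e, map_sub, hc 1 y hy, h0 y hy, sub_self]
    | succ j ih =>
      intro k hk hkm y hy
      by_cases hkl : k + 1 < m + 1
      · have := fderiv_shift_of_fderiv_eq_zero hW hρ hG h0 (Pi.single ⟨k + 1, hkl⟩ 1)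
          (ih (k + 1) hkl (by omega)) y hy
        rw [shiftCLM_single_succ, Pi.single_eq_of_ne (by simp [Fin.ext_iff])] at this
        rw [this]
        exact map_zero _
      · exact ih k hk (by omega) y hy
  intro y hy
  -- The shift kills `e_0`, so one more commutator leaves `0 = ∂G/∂u`.
  have := fderiv_shift_of_fderiv_eq_zero hW hρ hG h0 (Pi.single 0 1)
    (key m 0 (Nat.succ_pos m) (by omega)) y hy
  rw [shiftCLM_single_zero, Pi.single_eq_same] at this
  rw [← this]
  exact map_zero _

end Prolongation

/-! ### Total derivatives in finitely many coordinates -/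

section LocalRepresentation

variable {V : Type*} [NormedAddCommGroup V] [NormedSpace ℝ V]

theorem hasDerivAt_comp_of_trunc {f : Jet → V} {n : ℕ} {W : Set (ℝ × ℝ × (Fin n → ℝ))}
    {g : ℝ × ℝ × (Fin n → ℝ) → V} (hW : IsOpen W) (hfg : ∀ η : Jet, η.trunc n ∈ W → f η = g (η.trunc n))
    {y e : ℝ × ℝ × (Fin n → ℝ)} (hy : y ∈ W) (hg : DifferentiableAt ℝ g y) (p : ℝ → Jet) (s₀ : ℝ)
    (hp : ∀ s, (p s).trunc n = y + (s - s₀) • e) :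
    HasDerivAt (fun s => f (p s)) (fderiv ℝ g y e) s₀ := by
  have hl : HasDerivAt (fun s : ℝ => y + (s - s₀) • e) e s₀ := by
    simpa using (((hasDerivAt_id s₀).sub_const s₀).smul_const e).const_add y
  have hl0 : y + (s₀ - s₀) • e = y := by simp
  have h1 : HasDerivAt (fun s : ℝ => g (y + (s - s₀) • e)) (fderiv ℝ g y e) s₀ :=
    HasFDerivAt.comp_hasDerivAt s₀ (by rw [hl0]; exact hg.hasFDerivAt) hl
  refine h1.congr_of_eventuallyEq ?_
  filter_upwards [hl.continuousAt.preimage_mem_nhds (hW.mem_nhds (by rwa [hl0]))] with s hs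
  have hs' : (p s).trunc n ∈ W := by rw [hp]; exact hs
  rw [hfg _ hs', hp]

/-- Partial derivatives beyond the `n`-th coordinate vanish, so the formal sum is finite and is a
directional derivative. The free coefficients `c`, `d`, `a` let one statement serve both `D_x` and
`D_t`. -/
theorem partial_combination_eq_fderiv {f : Jet → V} {n : ℕ} {W : Set (ℝ × ℝ × (Fin n → ℝ))}
    {g : ℝ × ℝ × (Fin n → ℝ) → V} (hW : IsOpen W) (hfg : ∀ η : Jet, η.trunc n ∈ W → f η = g (η.trunc n))
    {θ : Jet} (hθ : θ.trunc n ∈ W) (hg : DifferentiableAt ℝ g (θ.trunc n)) (c d : ℝ) (a : ℕ → ℝ) :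
    c • partialT f θ + d • partialX f θ + ∑ᶠ k : ℕ, a k • partialU k f θ =
      fderiv ℝ g (θ.trunc n) (c, d, fun i => a i) := by
  have hT : partialT f θ = fderiv ℝ g (θ.trunc n) (1, 0, 0) :=
    (hasDerivAt_comp_of_trunc hW hfg hθ hg (fun s => (s, θ.x, θ.u)) θ.t
      (fun s => by simp [Jet.trunc, Jet.t, Jet.x, Jet.u])).deriv
  have hX : partialX f θ = fderiv ℝ g (θ.trunc n) (0, 1, 0) :=
    (hasDerivAt_comp_of_trunc hW hfg hθ hg (fun s => (θ.t, s, θ.u)) θ.x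
      (fun s => by simp [Jet.trunc, Jet.t, Jet.x, Jet.u])).deriv
  have hU : ∀ k : Fin n, partialU k f θ = fderiv ℝ g (θ.trunc n) (0, 0, Pi.single k 1) := by
    intro k
    refine (hasDerivAt_comp_of_trunc hW hfg hθ hg
      (fun s => (θ.t, θ.x, Function.update θ.u k s)) (θ.u k) (fun s => ?_)).deriv
    refine Prod.ext (by simp [Jet.trunc, Jet.t]) (Prod.ext (by simp [Jet.trunc, Jet.t, Jet.x]) ?_)
    funext i
    by_cases hik : i = k
    · subst hik; simp [Jet.trunc, Jet.u]
    · have : (i : ℕ) ≠ k := fun h => hik (Fin.ext h)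
      simp [Jet.trunc, Jet.u, hik, this]
  have hU0 : ∀ k : ℕ, n ≤ k → partialU k f θ = 0 := by
    intro k hk
    have := (hasDerivAt_comp_of_trunc (e := 0) hW hfg hθ hg
      (fun s => (θ.t, θ.x, Function.update θ.u k s)) (θ.u k) (fun s => ?_)).deriv
    · exact this.trans (map_zero _)
    refine Prod.ext (by simp [Jet.trunc, Jet.t]) (Prod.ext (by simp [Jet.trunc, Jet.t, Jet.x]) ?_)
    funext i
    have : (i : ℕ) ≠ k := by omega
    simp [Jet.trunc, Jet.u, this]
  have hsum : ∑ᶠ k : ℕ, a k • partialU k f θ =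
      ∑ k : Fin n, a k • fderiv ℝ g (θ.trunc n) (0, 0, Pi.single k 1) := by
    rw [finsum_eq_sum_of_support_subset (s := Finset.range n), Finset.sum_range]
    · exact Finset.sum_congr rfl fun k _ => by rw [hU]
    · intro k hk
      rw [Finset.coe_range, Set.mem_Iio]
      by_contra hkn
      exact hk (by simp only [hU0 k (not_lt.1 hkn), smul_zero])
  have hvec : ((c, d, fun i : Fin n => a i) : ℝ × ℝ × (Fin n → ℝ)) =
      c • (1, 0, 0) + d • (0, 1, 0) + ∑ k : Fin n, a k • (0, 0, Pi.single k 1) := by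
    have hpi : (fun i : Fin n => a i) = ∑ k : Fin n, a k • (Pi.single k 1 : Fin n → ℝ) := by
      funext i
      simp [Finset.sum_apply, Pi.single_apply]
    refine Prod.ext ?_ (Prod.ext ?_ ?_)
    · simp [Prod.fst_sum]
    · simp [Prod.snd_sum, Prod.fst_sum]
    · simp only [Prod.snd_add, Prod.smul_snd, Prod.snd_sum, smul_zero, zero_add, hpi]
  rw [hT, hX, hsum, hvec]
  simp only [map_add, map_smul, map_sum]

theorem totalX_eq_fderiv {f : Jet → V} {n : ℕ} {W : Set (ℝ × ℝ × (Fin n → ℝ))}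
    {g : ℝ × ℝ × (Fin n → ℝ) → V} (hW : IsOpen W) (hfg : ∀ η : Jet, η.trunc n ∈ W → f η = g (η.trunc n))
    {θ : Jet} (hθ : θ.trunc n ∈ W) (hg : DifferentiableAt ℝ g (θ.trunc n)) :
    totalX f θ = fderiv ℝ g (θ.trunc n) (0, 1, fun i => θ.u (i + 1)) := by
  rw [← partial_combination_eq_fderiv hW hfg hθ hg 0 1 (fun k => θ.u (k + 1)), totalX, zero_smul,
    one_smul, zero_add]

theorem totalT_eq_fderiv (F : Jet → ℝ) {f : Jet → V} {n : ℕ} {W : Set (ℝ × ℝ × (Fin n → ℝ))}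
    {g : ℝ × ℝ × (Fin n → ℝ) → V} (hW : IsOpen W) (hfg : ∀ η : Jet, η.trunc n ∈ W → f η = g (η.trunc n))
    {θ : Jet} (hθ : θ.trunc n ∈ W) (hg : DifferentiableAt ℝ g (θ.trunc n)) :
    totalT F f θ = fderiv ℝ g (θ.trunc n) (1, 0, fun i => (totalX^[i] F) θ) := by
  rw [← partial_combination_eq_fderiv hW hfg hθ hg 1 0 (fun k => (totalX^[k] F) θ), totalT,
    zero_smul, one_smul, add_zero]

/-- `D_x f` is the derivative of `f` along the line in the direction of the vector `D_x`. -/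
theorem SmoothOn.hasDerivAt_totalX {f : Jet → V} {U : Set Jet} (hf : SmoothOn f U) {θ : Jet}
    (hθ : θ ∈ U) :
    HasDerivAt (fun s : ℝ => f (θ.t, θ.x + s, fun k => θ.u k + s * θ.u (k + 1))) (totalX f θ) 0 := by
  obtain ⟨n, W, g, hW, hy, hg, hfg⟩ := hf θ hθ
  have hgd := (hg.contDiffAt (hW.mem_nhds hy)).differentiableAt (by simp)
  rw [totalX_eq_fderiv hW hfg hy hgd]
  refine hasDerivAt_comp_of_trunc hW hfg hy hgd _ 0 fun s => ?_
  refine Prod.ext (by simp [Jet.trunc, Jet.t]) (Prod.ext (by simp [Jet.trunc, Jet.t, Jet.x]) ?_)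
  funext i
  simp [Jet.trunc, Jet.u]

/-- `D_t f` is the derivative of `f` along the line in the direction of the vector `D_t`. -/
theorem SmoothOn.hasDerivAt_totalT (F : Jet → ℝ) {f : Jet → V} {U : Set Jet} (hf : SmoothOn f U)
    {θ : Jet} (hθ : θ ∈ U) :
    HasDerivAt (fun s : ℝ => f (θ.t + s, θ.x, fun k => θ.u k + s * (totalX^[k] F) θ))
      (totalT F f θ) 0 := by
  obtain ⟨n, W, g, hW, hy, hg, hfg⟩ := hf θ hθ
  have hgd := (hg.contDiffAt (hW.mem_nhds hy)).differentiableAt (by simp)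
  rw [totalT_eq_fderiv F hW hfg hy hgd]
  refine hasDerivAt_comp_of_trunc hW hfg hy hgd _ 0 fun s => ?_
  refine Prod.ext (by simp [Jet.trunc, Jet.t]) (Prod.ext (by simp [Jet.trunc, Jet.t, Jet.x]) ?_)
  funext i
  simp [Jet.trunc, Jet.u]

/-- Restriction of truncated jets to fewer coordinates. -/
def restrictCLM {n m : ℕ} (h : n ≤ m) : (ℝ × ℝ × (Fin m → ℝ)) →L[ℝ] (ℝ × ℝ × (Fin n → ℝ)) :=
  (ContinuousLinearMap.fst ℝ _ _).prod
    (((ContinuousLinearMap.fst ℝ _ _).comp (ContinuousLinearMap.snd ℝ _ _)).prod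
      (ContinuousLinearMap.pi fun i =>
        (ContinuousLinearMap.proj (Fin.castLE h i)).comp
          ((ContinuousLinearMap.snd ℝ _ _).comp (ContinuousLinearMap.snd ℝ _ _))))

/-- Near a point, a smooth function is represented by a smooth function of the first `m`
coordinates for every large `m`. -/
theorem SmoothOn.eventually_exists {f : Jet → V} {U : Set Jet} (hf : SmoothOn f U) {θ : Jet}
    (hθ : θ ∈ U) : ∀ᶠ m : ℕ in Filter.atTop, ∃ (W : Set (ℝ × ℝ × (Fin m → ℝ)))
      (g : ℝ × ℝ × (Fin m → ℝ) → V), IsOpen W ∧ θ.trunc m ∈ W ∧ ContDiffOn ℝ ∞ g W ∧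
      ∀ η : Jet, η.trunc m ∈ W → f η = g (η.trunc m) := by
  obtain ⟨n, W, g, hW, hy, hg, hfg⟩ := hf θ hθ
  filter_upwards [Filter.eventually_ge_atTop n] with m hm
  refine ⟨restrictCLM hm ⁻¹' W, g ∘ restrictCLM hm, hW.preimage (restrictCLM hm).continuous, hy,
    hg.comp (restrictCLM hm).contDiff.contDiffOn (fun _ h => h), fun η hη => hfg η hη⟩

/-- Basic open sets of the product topology restrict finitely many coordinates. Thus `U` contains
full cylinders, on which the higher `u_k` are unrestricted, as the highest-coordinate argument
requires. -/
theorem eventually_exists_trunc_subset {U : Set Jet} (hU : IsOpen U) {θ : Jet} (hθ : θ ∈ U) :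
    ∀ᶠ m : ℕ in Filter.atTop, ∃ W : Set (ℝ × ℝ × (Fin m → ℝ)), IsOpen W ∧ θ.trunc m ∈ W ∧
      ∀ η : Jet, η.trunc m ∈ W → η ∈ U := by
  obtain ⟨T, R, hT, hR, htT, hR', hTR⟩ := isOpen_prod_iff.1 hU θ.1 θ.2 hθ
  obtain ⟨X, Y, hX, hY, hxX, hyY, hXY⟩ := isOpen_prod_iff.1 hR θ.2.1 θ.2.2 hR'
  obtain ⟨I, v, hv, hvY⟩ := isOpen_pi_iff.1 hY θ.2.2 hyY
  filter_upwards [Filter.eventually_gt_atTop (I.sup id)] with m hm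
  have hIm : ∀ i ∈ I, i < m := fun i hi => (Finset.le_sup (f := id) hi).trans_lt hm
  refine ⟨T ×ˢ X ×ˢ {a | ∀ i : I, a ⟨i, hIm i i.2⟩ ∈ v i}, ?_, ?_, ?_⟩
  · refine hT.prod (hX.prod ?_)
    simp only [Set.ofPred_forall]
    exact isOpen_iInter_of_finite fun i => (hv i i.2).1.preimage (continuous_apply _)
  · exact ⟨htT, hxX, fun i => (hv i i.2).2⟩
  · rintro η ⟨h1, h2, h3⟩
    exact hTR ⟨h1, hXY ⟨h2, hvY fun i hi => h3 ⟨i, hi⟩⟩⟩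

end LocalRepresentation

/-! ### Projective solutions of the linear system -/

section Projectivization

variable {𝕜 : Type*} [RCLike 𝕜] {ι : Type*} [Fintype ι]

/-- The linear system `w ↦ (L + u⁻¹ diag l) w` in the affine chart `w j = 1` of the projective
space. -/
def projectiveField (L : Matrix ι ι 𝕜) (l : ι → 𝕜) (j : ι) (p : ℝ × (ι → 𝕜)) (i : ι) : 𝕜 :=
  ∑ k, L i k * p.2 k + p.1⁻¹ • (l i * p.2 i) - (∑ k, L j k * p.2 k + p.1⁻¹ • (l j * p.2 j)) * p.2 i

theorem differentiableAt_projectiveField (L : Matrix ι ι 𝕜) (l : ι → 𝕜) (j : ι)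
    {p : ℝ × (ι → 𝕜)} (hp : p.1 ≠ 0) : DifferentiableAt ℝ (projectiveField L l j) p := by
  refine differentiableAt_pi.2 fun i => ?_
  have h2 : ∀ k, DifferentiableAt ℝ (fun q : ℝ × (ι → 𝕜) => q.2 k) p := fun k => by fun_prop
  have h1 : DifferentiableAt ℝ (fun q : ℝ × (ι → 𝕜) => q.1⁻¹) p := differentiableAt_fst.inv hp
  have hs : ∀ i, DifferentiableAt ℝ
      (fun q : ℝ × (ι → 𝕜) => ∑ k, L i k * q.2 k + q.1⁻¹ • (l i * q.2 i)) p := fun i =>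
    (DifferentiableAt.fun_sum fun k _ => (h2 k).const_mul (L i k)).add
      (h1.smul ((h2 i).const_mul (l i)))
  exact (hs i).sub ((hs j).mul (h2 i))

/-- Only the terms with `u⁻¹` contribute. At `r j = 1` the result is `-u⁻² (l i - l j) r i`, so its
vanishing for distinct `l` forces `r` to be the `j`-th basis vector. -/
theorem fderiv_projectiveField (L : Matrix ι ι 𝕜) (l : ι → 𝕜) (j : ι)
    {u : ℝ} (hu : u ≠ 0) (r : ι → 𝕜) (i : ι) :
    fderiv ℝ (projectiveField L l j) (u, r) (1, 0) i =
      (-(u ^ 2)⁻¹) • (l i * r i) - (-(u ^ 2)⁻¹) • (l j * r j) * r i := by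
  have h1 : HasDerivAt (fun s : ℝ => (s, r)) (1, 0) u :=
    (hasDerivAt_id u).prodMk (hasDerivAt_const u r)
  have h2 := (differentiableAt_projectiveField L l j (p := (u, r)) hu).hasFDerivAt.comp_hasDerivAt
    u h1
  have h3 := hasDerivAt_pi.1 h2 i
  have hi : ∀ c : 𝕜, HasDerivAt (fun s : ℝ => s⁻¹ • c) ((-(u ^ 2)⁻¹) • c) u := fun c =>
    (hasDerivAt_inv hu).smul_const c
  have h4 := ((hi (l i * r i)).const_add (∑ k, L i k * r k)).sub
    (((hi (l j * r j)).const_add (∑ k, L j k * r k)).mul_const (r i))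
  exact h3.unique h4

/-- A projective solution, depending on finitely many jet coordinates, of the linear system
`D_x w = (L + u⁻¹ diag l) w` with distinct `l i` and with no basis vector an eigenvector of `L`
vanishes. -/
theorem eq_zero_of_projective_solution {m : ℕ} {W : Set (ℝ × ℝ × (Fin (m + 1) → ℝ))}
    (hW : IsOpen W) (hu : ∀ y ∈ W, y.2.2 0 ≠ 0) (L : Matrix ι ι 𝕜) (l : ι → 𝕜)
    (hl : Function.Injective l) (hL : ∀ j, ∃ i, i ≠ j ∧ L i j ≠ 0)
    (w : ι → ℝ × ℝ × (Fin (m + 1) → ℝ) → 𝕜) (hw : ∀ i, ContDiffOn ℝ ∞ (w i) W)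
    (h : ∀ θ : Jet, θ.trunc (m + 1) ∈ W → ∃ a : 𝕜, ∀ i,
      fderiv ℝ (w i) (θ.trunc (m + 1)) (0, 1, fun i => θ.u (i + 1)) =
        ∑ k, L i k * w k (θ.trunc (m + 1)) + (θ.u 0)⁻¹ • (l i * w i (θ.trunc (m + 1))) +
          a * w i (θ.trunc (m + 1))) :
    ∀ y ∈ W, ∀ j, w j y = 0 := by
  classical
  intro y₀ hy₀ j
  by_contra hj
  -- The affine chart is available on the open set where `w j ≠ 0`.
  set W' := W ∩ w j ⁻¹' {0}ᶜ with hW'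
  have hW'o : IsOpen W' := (hw j).continuousOn.isOpen_inter_preimage hW isOpen_compl_singleton
  have hW'W : W' ⊆ W := Set.inter_subset_left
  have hne : ∀ y ∈ W', w j y ≠ 0 := fun y hy => hy.2
  set ρ : ℝ × ℝ × (Fin (m + 1) → ℝ) → (ι → 𝕜) := fun y i => w i y * (w j y)⁻¹ with hρdef
  have hρ : ContDiffOn ℝ ∞ ρ W' := contDiffOn_pi.2 fun i =>
    ((hw i).mono hW'W).mul (((hw j).mono hW'W).inv hne)
  have hρj : ∀ y ∈ W', ρ y j = 1 := fun y hy => mul_inv_cancel₀ (hne y hy)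
  have hG : ∀ y ∈ W', DifferentiableAt ℝ (projectiveField L l j) (y.2.2 0, ρ y) :=
    fun y hy => differentiableAt_projectiveField L l j (hu y (hW'W hy))
  have heq : ∀ θ : Jet, θ.trunc (m + 1) ∈ W' →
      fderiv ℝ ρ (θ.trunc (m + 1)) (0, 1, fun i => θ.u (i + 1)) =
        projectiveField L l j (θ.u 0, ρ (θ.trunc (m + 1))) := by
    intro θ hθ
    obtain ⟨a, ha⟩ := h θ (hW'W hθ)
    set y := θ.trunc (m + 1)
    have hnhds := hW.mem_nhds (hW'W hθ)
    have hd : ∀ i, DifferentiableAt ℝ (w i) y := fun i =>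
      ((hw i).contDiffAt hnhds).differentiableAt (by simp)
    have hρd : DifferentiableAt ℝ ρ y :=
      (hρ.contDiffAt (hW'o.mem_nhds hθ)).differentiableAt (by simp)
    have hline : HasDerivAt (fun s : ℝ => y + s • ((0 : ℝ), (1 : ℝ), fun i : Fin (m + 1) => θ.u (i + 1)))
        (0, 1, fun i => θ.u (i + 1)) 0 := by
      simpa using ((hasDerivAt_id (0 : ℝ)).smul_const
        ((0 : ℝ), (1 : ℝ), fun i : Fin (m + 1) => θ.u (i + 1))).const_add y
    have h0 : y + (0 : ℝ) • ((0 : ℝ), (1 : ℝ), fun i : Fin (m + 1) => θ.u (i + 1)) = y := by simp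
    have hwl : ∀ i, HasDerivAt (fun s : ℝ =>
        w i (y + s • ((0 : ℝ), (1 : ℝ), fun i : Fin (m + 1) => θ.u (i + 1)))) _ 0 := fun i =>
      HasFDerivAt.comp_hasDerivAt 0 (by rw [h0]; exact (hd i).hasFDerivAt) hline
    have hρl := HasFDerivAt.comp_hasDerivAt 0 (by rw [h0]; exact hρd.hasFDerivAt) hline
    funext i
    -- In the quotient rule the unknown scalar `a` cancels between `w i` and `w j`.
    have h1 := (hasDerivAt_pi.1 hρl i).unique
      ((hwl i).mul ((hwl j).inv (by rw [h0]; exact hne y hθ)))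
    rw [h1]
    beta_reduce
    rw [h0, ha, ha]
    have hjj := hne y hθ
    have hsum : ∀ i, ∑ k, L i k * ρ y k = (∑ k, L i k * w k y) * (w j y)⁻¹ := fun i => by
      rw [Finset.sum_mul]
      exact Finset.sum_congr rfl fun k _ => (mul_assoc _ _ _).symm
    simp only [projectiveField, hsum]
    simp only [hρdef, RCLike.real_smul_eq_coe_mul]
    field_simp
    ring
  have hz := fderiv_eq_zero_of_totalX_eq hW'o hρ hG heq
  have hbasis : ∀ y ∈ W', ρ y = Pi.single j 1 := by
    intro y hy
    funext i
    by_cases hij : i = j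
    · subst hij; rw [hρj y hy, Pi.single_eq_same]
    · rw [Pi.single_eq_of_ne hij]
      have h1 := congrFun (hz y hy) i
      have huy := hu y (hW'W hy)
      rw [fderiv_projectiveField L l j huy, hρj y hy, mul_one, smul_mul_assoc, ← smul_sub,
        ← sub_mul, Pi.zero_apply] at h1
      have h2 := (smul_eq_zero.1 h1).resolve_left (neg_ne_zero.2 (inv_ne_zero (pow_ne_zero 2 huy)))
      exact (mul_eq_zero.1 h2).resolve_left (sub_ne_zero.2 fun hll => hij (hl hll))
  have hy₀' : y₀ ∈ W' := ⟨hy₀, hj⟩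
  have hfd : fderiv ℝ ρ y₀ = 0 := by
    have := (hasFDerivAt_const (𝕜 := ℝ) (Pi.single j 1 : ι → 𝕜) y₀).congr_of_eventuallyEq
      (Filter.eventuallyEq_of_mem (hW'o.mem_nhds hy₀') hbasis)
    exact this.fderiv
  -- At the constant `ρ = e_j` the `i`-th component of the equation reads `0 = L i j`.
  obtain ⟨i, hij, hLij⟩ := hL j
  have h1 := congrFun (heq (extendJet 0 y₀) (by rwa [trunc_extendJet])) i
  rw [trunc_extendJet, hfd, hbasis y₀ hy₀'] at h1
  simp [projectiveField, Pi.single_apply, hij] at h1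
  exact hLij h1.symm

end Projectivization

/-! ### Proper subalgebras of `sl₂` -/

section Subalgebras

attribute [local instance] LieRing.ofAssociativeRing

variable {𝕜 : Type*} [RCLike 𝕜]

theorem mem_sl₂_iff {X : Matrix (Fin 2) (Fin 2) 𝕜} : X ∈ sl₂ 𝕜 ↔ X.trace = 0 := Iff.rfl

theorem finrank_sl₂_le : Module.finrank 𝕜 (sl₂ 𝕜).toSubmodule ≤ 3 := by
  let φ : (sl₂ 𝕜).toSubmodule →ₗ[𝕜] (Fin 3 → 𝕜) :=
    { toFun := fun X => ![X.1 0 0, X.1 0 1, X.1 1 0]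
      map_add' := fun X Y => by ext i; fin_cases i <;> rfl
      map_smul' := fun c X => by ext i; fin_cases i <;> rfl }
  have hφ : Function.Injective φ := by
    rw [← LinearMap.ker_eq_bot, LinearMap.ker_eq_bot']
    rintro ⟨X, hX⟩ h
    have hX' : X 0 0 + X 1 1 = 0 := by
      rw [← Matrix.trace_fin_two]; exact hX
    have h0 : X 0 0 = 0 := congrFun h 0
    have h1 : X 0 1 = 0 := congrFun h 1
    have h2 : X 1 0 = 0 := congrFun h 2
    rw [h0, zero_add] at hX'
    refine Subtype.ext ?_
    ext i j
    fin_cases i <;> fin_cases j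
    exacts [h0, h1, h2, hX']
  simpa using LinearMap.finrank_le_finrank_of_injective hφ

/-- A proper subalgebra of `sl₂` stabilizes a line in `sl₂`. -/
theorem exists_stable_line {𝔥 : LieSubalgebra 𝕜 (Matrix (Fin 2) (Fin 2) 𝕜)} (h𝔥 : 𝔥 < sl₂ 𝕜) :
    ∃ N : Matrix (Fin 2) (Fin 2) 𝕜, N ≠ 0 ∧ N.trace = 0 ∧
      ∀ X ∈ 𝔥, ∃ c : 𝕜, N * X - X * N = c • N := by
  -- The line is sought in `sl₂` rather than in `𝕜²` so that `ℝ` is covered too: a rotation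
  -- subalgebra fixes no line of `ℝ²`, but it normalizes itself. A nonzero abelian subalgebra is
  -- centralized by any of its elements; a nonabelian proper one is two-dimensional, and its derived
  -- algebra is a line.
  by_cases hab : ∀ X ∈ 𝔥, ∀ Y ∈ 𝔥, X * Y - Y * X = 0
  · by_cases hbot : ∀ X ∈ 𝔥, X = 0
    · refine ⟨!![0, 1; 0, 0], fun h => one_ne_zero (congrFun (congrFun h 0) 1),
        by simp [Matrix.trace_fin_two], fun X hX => ⟨0, ?_⟩⟩
      rw [hbot X hX]
      simp
    · push Not at hbot
      obtain ⟨N, hN, hN0⟩ := hbot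
      exact ⟨N, hN0, h𝔥.le hN, fun X hX => ⟨0, by rw [hab N hN X hX, zero_smul]⟩⟩
  · push Not at hab
    obtain ⟨X, hX, Y, hY, hXY⟩ := hab
    have hN : X * Y - Y * X ∈ 𝔥 := 𝔥.lie_mem hX hY
    refine ⟨X * Y - Y * X, hXY, h𝔥.le hN, ?_⟩
    -- Bracketing a linear relation with `Y` and with `X` isolates each coefficient times `[X, Y] ≠
    -- 0`.
    have hli : LinearIndependent 𝕜 ![X, Y] := by
      rw [LinearIndependent.pair_iff]
      intro s t hst
      have hs : s • (X * Y - Y * X) = (s • X + t • Y) * Y - Y * (s • X + t • Y) := by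
        simp only [add_mul, mul_add, smul_mul_assoc, mul_smul_comm, smul_sub]; abel
      have ht : t • (X * Y - Y * X) = X * (s • X + t • Y) - (s • X + t • Y) * X := by
        simp only [add_mul, mul_add, smul_mul_assoc, mul_smul_comm, smul_sub]; abel
      rw [hst] at hs ht
      simp only [zero_mul, mul_zero, sub_zero] at hs ht
      exact ⟨(smul_eq_zero.1 hs).resolve_right hXY, (smul_eq_zero.1 ht).resolve_right hXY⟩
    have hle : Submodule.span 𝕜 (Set.range ![X, Y]) ≤ 𝔥.toSubmodule := by
      rw [Submodule.span_le]
      rintro _ ⟨i, rfl⟩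
      fin_cases i
      exacts [hX, hY]
    have hlt : 𝔥.toSubmodule < (sl₂ 𝕜).toSubmodule := h𝔥
    have hspan : Submodule.span 𝕜 (Set.range ![X, Y]) = 𝔥.toSubmodule := by
      refine Submodule.eq_of_le_of_finrank_le hle ?_
      rw [finrank_span_eq_card hli, Fintype.card_fin]
      have := Submodule.finrank_lt_finrank_of_lt hlt
      have := finrank_sl₂_le (𝕜 := 𝕜)
      omega
    have hcomb : ∀ Z ∈ 𝔥, ∃ a b : 𝕜, a • X + b • Y = Z := by
      intro Z hZ
      have : Z ∈ Submodule.span 𝕜 (Set.range ![X, Y]) := by rw [hspan]; exact hZ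
      rw [Matrix.range_cons, Matrix.range_cons, Matrix.range_empty, Set.union_empty,
        Set.singleton_union] at this
      exact Submodule.mem_span_pair.1 this
    intro Z hZ
    obtain ⟨a, b, rfl⟩ := hcomb Z hZ
    obtain ⟨c, d, hcd⟩ := hcomb _ hN
    refine ⟨c * b - d * a, ?_⟩
    have : (c • X + d • Y) * (a • X + b • Y) - (a • X + b • Y) * (c • X + d • Y) =
        (c * b - d * a) • (X * Y - Y * X) := by
      simp only [add_mul, mul_add, smul_mul_assoc, mul_smul_comm]
      module
    rwa [hcd] at this

end Subalgebras

/-! ### Transport of a stable line by the gauge transformation -/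

section Gauge

variable {𝕜 : Type*} [RCLike 𝕜]

/-- `adj(S) N S` for `2 × 2` matrices, as the vector of its entries `11, 12, 21`. -/
def conjEntries (N S : Matrix (Fin 2) (Fin 2) 𝕜) : Fin 3 → 𝕜 :=
  ![(S.adjugate * N * S) 0 0, (S.adjugate * N * S) 0 1, (S.adjugate * N * S) 1 0]

/-- The constant part of `ad A` in the coordinates `11, 12, 21` of `sl₂`. -/
def adConst (𝕜 : Type*) [RCLike 𝕜] : Matrix (Fin 3) (Fin 3) 𝕜 := !![0, -1, 1; -2, 0, 0; 2, 0, 0]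

theorem conj_adjugate_apply (N S : Matrix (Fin 2) (Fin 2) 𝕜) (i j : Fin 2) :
    (S.adjugate * N * S) i j = ∑ l, ∑ k, S.adjugate i k * N k l * S l j := by
  simp only [Matrix.mul_apply, Finset.sum_mul]

theorem adjugate_conj_ne_zero {N S : Matrix (Fin 2) (Fin 2) 𝕜} (hS : S.det = 1) (hN : N ≠ 0)
    (htr : N.trace = 0) : conjEntries N S ≠ 0 := by
  intro h
  have h0 : (S.adjugate * N * S) 0 0 = 0 := congrFun h 0
  have h1 : (S.adjugate * N * S) 0 1 = 0 := congrFun h 1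
  have h2 : (S.adjugate * N * S) 1 0 = 0 := congrFun h 2
  have hSS : S * S.adjugate = 1 := by rw [Matrix.mul_adjugate, hS, one_smul]
  have ht : (S.adjugate * N * S).trace = 0 := by
    rw [Matrix.trace_mul_cycle, hSS, one_mul, htr]
  rw [Matrix.trace_fin_two, h0, zero_add] at ht
  have hQ : S.adjugate * N * S = 0 := by
    ext i j
    fin_cases i <;> fin_cases j
    exacts [h0, h1, h2, ht]
  apply hN
  have : S * (S.adjugate * N * S) * S.adjugate = (S * S.adjugate) * N * (S * S.adjugate) := by
    simp only [mul_assoc]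
  rw [hQ, hSS] at this
  simpa using this.symm

/-- Leibniz rule for `adj(S) N S`. -/
theorem hasDerivAt_conjEntries (N : Matrix (Fin 2) (Fin 2) 𝕜)
    {S : ℝ → Matrix (Fin 2) (Fin 2) 𝕜} {S' : Matrix (Fin 2) (Fin 2) 𝕜} {s : ℝ}
    (h : ∀ i j, HasDerivAt (fun r => S r i j) (S' i j) s) (i : Fin 3) :
    HasDerivAt (fun r => conjEntries N (S r) i)
      (![(S'.adjugate * N * S s + (S s).adjugate * N * S') 0 0,
        (S'.adjugate * N * S s + (S s).adjugate * N * S') 0 1,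
        (S'.adjugate * N * S s + (S s).adjugate * N * S') 1 0] i) s := by
  have hadj : ∀ i j, HasDerivAt (fun r => (S r).adjugate i j) (S'.adjugate i j) s := by
    intro i j
    simp only [Matrix.adjugate_fin_two]
    fin_cases i <;> fin_cases j
    exacts [h 1 1, (h 0 1).neg, (h 1 0).neg, h 0 0]
  have hQ : ∀ i j, HasDerivAt (fun r => ((S r).adjugate * N * S r) i j)
      ((S'.adjugate * N * S s + (S s).adjugate * N * S') i j) s := by
    intro i j
    simp only [Matrix.add_apply, Matrix.mul_apply, Finset.sum_mul,
      ← Finset.sum_add_distrib]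
    exact HasDerivAt.fun_sum fun l _ => HasDerivAt.fun_sum fun k _ =>
      ((hadj i k).mul_const (N k l)).mul (h l j)
  fin_cases i
  exacts [hQ 0 0, hQ 0 1, hQ 1 0]

/-- The hypothesis on `S'` is the gauge relation multiplied by `S` on the right. For `2 × 2`
matrices `adj X = tr X - X` is linear, so `adj S` differentiates like `S`, and with `adj` in place
of the inverse no determinant condition enters. The trace of `A'` joins the scalar factor, so `A'`
need not be traceless. -/
theorem adjugate_conj_derivative {N S S' A A' : Matrix (Fin 2) (Fin 2) 𝕜} {c : 𝕜}
    (hA : A.trace = 0) (hc : N * A' - A' * N = c • N) (hS' : S' = A' * S - S * A) :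
    S'.adjugate * N * S + S.adjugate * N * S' =
      A * (S.adjugate * N * S) - S.adjugate * N * S * A + (c + A'.trace) • (S.adjugate * N * S) := by
  have hadj : ∀ X : Matrix (Fin 2) (Fin 2) 𝕜, X.adjugate = X.trace • 1 - X := by
    intro X
    rw [Matrix.adjugate_fin_two, Matrix.trace_fin_two]
    ext i j
    fin_cases i <;> fin_cases j <;> simp
  have h1 : S'.adjugate = S.adjugate * A'.adjugate - A.adjugate * S.adjugate := by
    rw [← Matrix.adjugate_mul_distrib, ← Matrix.adjugate_mul_distrib, hS', hadj, hadj, hadj,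
      Matrix.trace_sub, sub_smul]
    abel
  have h2 : N * A' = A' * N + c • N := by rw [← hc]; abel
  rw [h1, hadj A', hadj A, hA, hS']
  simp only [mul_sub, sub_mul, mul_assoc, zero_smul, smul_mul_assoc, mul_smul_comm, one_mul, zero_sub,
    neg_mul, add_smul]
  rw [← mul_assoc N A' S, h2]
  simp only [add_mul, mul_add, smul_mul_assoc, mul_smul_comm, mul_assoc]
  abel

theorem matrixA_trace (θ : Jet) : (matrixA 𝕜 θ).trace = 0 := by
  simp [matrixA, Matrix.trace_fin_two]

/-- A form gauge equivalent to `A dx + B dt` normalizes no line in `sl₂`. -/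
theorem not_exists_stable_line {F : Jet → ℝ} {U : Set Jet} (hU : IsOpen U) (hne : U.Nonempty)
    (hu : ∀ θ ∈ U, θ.u 0 ≠ 0) {B A' B' : Jet → Matrix (Fin 2) (Fin 2) 𝕜}
    (hg : GaugeEquivOn F U (matrixA 𝕜) B A' B') {N : Matrix (Fin 2) (Fin 2) 𝕜} (hN : N ≠ 0)
    (htr : N.trace = 0) (hst : ∀ θ ∈ U, ∃ c : 𝕜, N * A' θ - A' θ * N = c • N) : False := by
  obtain ⟨S, hS, hgauge⟩ := hg
  obtain ⟨θ₀, hθ₀⟩ := hne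
  -- One truncation order serves the neighbourhood inside `U` and all four entries of `S`; it is at
  -- least `1` so that `u_0` is among the coordinates.
  have hev := (eventually_exists_trunc_subset hU hθ₀).and
    ((Filter.eventually_all.2 fun i => Filter.eventually_all.2 fun j =>
      (hS i j).eventually_exists hθ₀).and (Filter.eventually_ge_atTop 1))
  obtain ⟨n, ⟨W₀, hW₀, hyW₀, hW₀U⟩, hrep, hn⟩ := hev.exists
  obtain ⟨m, rfl⟩ : ∃ m, n = m + 1 := ⟨n - 1, by omega⟩
  choose W₁ g hW₁ hyW₁ hgs hSg using hrep
  set W := W₀ ∩ ⋂ i, ⋂ j, W₁ i j with hWdef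
  have hW : IsOpen W :=
    hW₀.inter (isOpen_iInter_of_finite fun i => isOpen_iInter_of_finite fun j => hW₁ i j)
  have hy : θ₀.trunc (m + 1) ∈ W :=
    ⟨hyW₀, Set.mem_iInter.2 fun i => Set.mem_iInter.2 fun j => hyW₁ i j⟩
  have hWW : ∀ i j, W ⊆ W₁ i j := fun i j y hy => Set.mem_iInter.1 (Set.mem_iInter.1 hy.2 i) j
  have hgW : ∀ i j, ContDiffOn ℝ ∞ (g i j) W := fun i j => (hgs i j).mono (hWW i j)
  set M : ℝ × ℝ × (Fin (m + 1) → ℝ) → Matrix (Fin 2) (Fin 2) 𝕜 := fun y => Matrix.of fun i j => g i j y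
    with hMdef
  have hMS : ∀ θ : Jet, θ.trunc (m + 1) ∈ W → M (θ.trunc (m + 1)) = S θ := by
    intro θ hθ
    ext i j
    exact (hSg i j θ (hWW i j hθ)).symm
  have hw : ∀ i, ContDiffOn ℝ ∞ (fun y => conjEntries N (M y) i) W := by
    have hadj : ∀ i j, ContDiffOn ℝ ∞ (fun y => (M y).adjugate i j) W := by
      intro i j
      simp only [Matrix.adjugate_fin_two]
      fin_cases i <;> fin_cases j
      exacts [hgW 1 1, (hgW 0 1).neg, (hgW 1 0).neg, hgW 0 0]
    have hQ : ∀ i j, ContDiffOn ℝ ∞ (fun y => ((M y).adjugate * N * M y) i j) W := by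
      intro i j
      simp only [conj_adjugate_apply]
      exact ContDiffOn.sum fun l _ => ContDiffOn.sum fun k _ =>
        ((hadj i k).mul contDiffOn_const).mul (hgW l j)
    intro i
    fin_cases i
    exacts [hQ 0 0, hQ 0 1, hQ 1 0]
  have hzero := eq_zero_of_projective_solution hW (fun y hy => ?_) (adConst 𝕜) ![0, 2, -2] ?_ ?_
    (fun i y => conjEntries N (M y) i) hw ?_ _ hy
  · refine adjugate_conj_ne_zero (S θ₀).2 hN htr (funext fun i => ?_)
    have := hzero i
    simpa only [hMS θ₀ hy, Pi.zero_apply] using this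
  · have := hu _ (hW₀U (extendJet 0 y) (by rw [trunc_extendJet]; exact hy.1))
    rwa [extendJet_u_zero] at this
  · intro i j hij
    fin_cases i <;> fin_cases j <;> first | rfl | (exfalso; revert hij; norm_num)
  · intro j
    fin_cases j
    · exact ⟨1, by decide, by simp [adConst]⟩
    · exact ⟨0, by decide, by simp [adConst]⟩
    · exact ⟨0, by decide, by simp [adConst]⟩
  · intro θ hθ
    have hθU : θ ∈ U := hW₀U θ hθ.1
    obtain ⟨c, hc⟩ := hst θ hθU
    obtain ⟨hA', -⟩ := hgauge θ hθU
    set S' := matrixTotalX (fun η => (S η : Matrix (Fin 2) (Fin 2) 𝕜)) θ with hS'def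
    have hinv : (((S θ)⁻¹ : SL(2, 𝕜)) : Matrix (Fin 2) (Fin 2) 𝕜) * (S θ).1 = 1 := by
      rw [← Matrix.SpecialLinearGroup.coe_mul, inv_mul_cancel, Matrix.SpecialLinearGroup.coe_one]
    have hS' : S' = A' θ * (S θ).1 - (S θ).1 * matrixA 𝕜 θ := by
      rw [hA', add_mul, mul_assoc, hinv, mul_assoc, hinv, mul_one, mul_one, add_sub_cancel_right]
    refine ⟨c + (A' θ).trace, fun i => ?_⟩
    set y := θ.trunc (m + 1) with hydef
    have hWy := hW.mem_nhds hθ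
    set v : ℝ × ℝ × (Fin (m + 1) → ℝ) := (0, 1, fun i => θ.u (i + 1)) with hv
    have hline : HasDerivAt (fun s : ℝ => y + s • v) v 0 := by
      simpa using ((hasDerivAt_id (0 : ℝ)).smul_const v).const_add y
    have h0 : y + (0 : ℝ) • v = y := by simp
    have hgd : ∀ i j, DifferentiableAt ℝ (g i j) y := fun i j =>
      ((hgW i j).contDiffAt hWy).differentiableAt (by simp)
    have hM' : ∀ i j, HasDerivAt (fun s : ℝ => M (y + s • v) i j) (S' i j) 0 := by
      intro i j
      have h1 : S' i j = fderiv ℝ (g i j) y v :=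
        totalX_eq_fderiv (hW₁ i j) (hSg i j) (hWW i j hθ) (hgd i j)
      rw [h1]
      exact HasFDerivAt.comp_hasDerivAt 0 (by rw [h0]; exact (hgd i j).hasFDerivAt) hline
    have hder := hasDerivAt_conjEntries N hM' i
    have hwd : DifferentiableAt ℝ (fun y => conjEntries N (M y) i) y :=
      ((hw i).contDiffAt hWy).differentiableAt (by simp)
    have hder' := HasFDerivAt.comp_hasDerivAt 0 (l := fun y => conjEntries N (M y) i)
      (by rw [h0]; exact hwd.hasFDerivAt) hline
    rw [hder'.unique hder, h0, hMS θ hθ, adjugate_conj_derivative (matrixA_trace θ) hc hS']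
    -- Conjugation preserves the zero trace, so the entry `22` is determined by the three
    -- coordinates used.
    have hQtr : ((S θ).1.adjugate * N * (S θ).1) 1 1 = -((S θ).1.adjugate * N * (S θ).1) 0 0 := by
      rw [eq_neg_iff_add_eq_zero, add_comm, ← Matrix.trace_fin_two, Matrix.trace_mul_cycle,
        Matrix.mul_adjugate, (S θ).2, one_smul, one_mul, htr]
    simp only [conjEntries, Fin.sum_univ_three]
    generalize (S θ).1.adjugate * N * (S θ).1 = Q at hQtr
    fin_cases i 
    · simp [adConst, matrixA, Matrix.mul_apply]
      ring
    · simp [adConst, matrixA, Matrix.mul_apply, hQtr, RCLike.real_smul_eq_coe_mul]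
      ring
    · simp [adConst, matrixA, Matrix.mul_apply, hQtr, RCLike.real_smul_eq_coe_mul]
      ring

end Gauge

/-! ### Smoothness and total derivatives of the coefficients -/

section Coefficients

variable {Ω : Set (ℝ × ℝ)} {β : ℝ → ℝ → ℝ}

theorem iteratedDeriv_succ_eq_fderiv {k : ℕ} (hΩ : IsOpen Ω)
    (h : ContDiffOn ℝ ∞ (fun q : ℝ × ℝ => iteratedDeriv k (β q.1) q.2) Ω) {q : ℝ × ℝ} (hq : q ∈ Ω) :
    HasDerivAt (iteratedDeriv k (β q.1))
      (fderiv ℝ (fun q : ℝ × ℝ => iteratedDeriv k (β q.1) q.2) q (0, 1)) q.2 := by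
  have hd := ((h.contDiffAt (hΩ.mem_nhds hq)).differentiableAt (by simp)).hasFDerivAt
  have hl : HasDerivAt (fun s : ℝ => (q.1, s)) (0, 1) q.2 :=
    (hasDerivAt_const q.2 q.1).prodMk (hasDerivAt_id q.2)
  exact hd.comp_hasDerivAt q.2 hl

/-- The one-variable derivatives with `t` frozen are identified inductively with the joint
derivative in the direction `(0, 1)`, which keeps them jointly smooth. -/
theorem contDiffOn_iteratedDeriv (hΩ : IsOpen Ω)
    (hβ : ContDiffOn ℝ ∞ (fun q : ℝ × ℝ => β q.1 q.2) Ω) (k : ℕ) :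
    ContDiffOn ℝ ∞ (fun q : ℝ × ℝ => iteratedDeriv k (β q.1) q.2) Ω := by
  induction k with
  | zero => simpa only [iteratedDeriv_zero] using hβ
  | succ k ih =>
    have h1 : ContDiffOn ℝ ∞ (fun q : ℝ × ℝ =>
        fderiv ℝ (fun q : ℝ × ℝ => iteratedDeriv k (β q.1) q.2) q (0, 1)) Ω :=
      (ih.fderiv_of_isOpen hΩ (by simp)).clm_apply contDiffOn_const
    refine h1.congr fun q hq => ?_
    rw [iteratedDeriv_succ, (iteratedDeriv_succ_eq_fderiv hΩ ih hq).deriv]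

theorem hasDerivAt_iteratedDeriv (hΩ : IsOpen Ω)
    (hβ : ContDiffOn ℝ ∞ (fun q : ℝ × ℝ => β q.1 q.2) Ω) (k : ℕ) {t x : ℝ} (hq : (t, x) ∈ Ω) :
    HasDerivAt (fun s : ℝ => iteratedDeriv k (β t) (x + s)) (iteratedDeriv (k + 1) (β t) x) 0 := by
  have h1 := iteratedDeriv_succ_eq_fderiv hΩ (contDiffOn_iteratedDeriv hΩ hβ k) hq
  have h2 := h1
  rw [← h1.deriv, ← iteratedDeriv_succ] at h2
  refine HasDerivAt.comp_const_add x 0 ?_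
  rwa [add_zero]

theorem isOpen_truncated_region (hΩ : IsOpen Ω) :
    IsOpen {y : ℝ × ℝ × (Fin 2 → ℝ) | (y.1, y.2.1) ∈ Ω ∧ y.2.2 0 ≠ 0} :=
  (hΩ.preimage (by fun_prop)).inter
    (isOpen_compl_singleton.preimage (f := fun y : ℝ × ℝ × (Fin 2 → ℝ) => y.2.2 0) (by fun_prop))

theorem smoothOn_ofReal (𝕜 : Type*) [RCLike 𝕜] (hΩ : IsOpen Ω) {U : Set Jet}
    (hU : U ⊆ regularRegion Ω) {f : Jet → ℝ} (g : ℝ × ℝ × (Fin 2 → ℝ) → ℝ)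
    (hg : ContDiffOn ℝ ∞ g {y | (y.1, y.2.1) ∈ Ω ∧ y.2.2 0 ≠ 0})
    (hfg : ∀ η : Jet, f η = g (η.trunc 2)) : SmoothOn (fun η => (f η : 𝕜)) U := by
  intro θ hθ
  refine ⟨2, _, fun y => (g y : 𝕜), isOpen_truncated_region hΩ, hU hθ, ?_, fun η _ => congrArg _ (hfg η)⟩
  exact (RCLike.ofRealCLM (K := 𝕜)).contDiff.comp_contDiffOn hg

variable {𝕜 : Type*} [RCLike 𝕜]

theorem hasDerivAt_ofReal_comp {f : ℝ → ℝ} {d s : ℝ} (h : HasDerivAt f d s) :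
    HasDerivAt (fun r => (f r : 𝕜)) (d : 𝕜) s :=
  (RCLike.ofRealCLM (K := 𝕜)).hasFDerivAt.comp_hasDerivAt s h

/-- Reduces `D_x` of an explicit entry to real one-variable calculus along a line, for `𝕜 = ℝ` and
`ℂ` at once. -/
theorem totalX_ofReal_eq {f : Jet → ℝ} {U : Set Jet} (hf : SmoothOn (fun η => (f η : 𝕜)) U)
    {θ : Jet} (hθ : θ ∈ U) {d : ℝ}
    (h : HasDerivAt (fun s : ℝ => f (θ.t, θ.x + s, fun k => θ.u k + s * θ.u (k + 1))) d 0) :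
    totalX (fun η => (f η : 𝕜)) θ = (d : 𝕜) :=
  (hf.hasDerivAt_totalX hθ).unique (hasDerivAt_ofReal_comp h)

theorem totalT_ofReal_eq (F : Jet → ℝ) {f : Jet → ℝ} {U : Set Jet}
    (hf : SmoothOn (fun η => (f η : 𝕜)) U) {θ : Jet} (hθ : θ ∈ U) {d : ℝ}
    (h : HasDerivAt (fun s : ℝ => f (θ.t + s, θ.x, fun k => θ.u k + s * (totalX^[k] F) θ)) d 0) :
    totalT F (fun η => (f η : 𝕜)) θ = (d : 𝕜) :=
  (hf.hasDerivAt_totalT F hθ).unique (hasDerivAt_ofReal_comp h)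

end Coefficients

/-! ### The zero-curvature identity -/

section Representation

/-- The real matrix underlying `matrixA`. -/
def realA (θ : Jet) : Matrix (Fin 2) (Fin 2) ℝ := !![1 / θ.u 0, 1; 1, -(1 / θ.u 0)]

/-- The real matrix underlying `matrixB`. -/
def realB (β : ℝ → ℝ → ℝ) (θ : Jet) : Matrix (Fin 2) (Fin 2) ℝ :=
  !![entryB β θ, 4 * β θ.t θ.x + 2 * derivX 1 β θ * θ.u 0;
     4 * β θ.t θ.x - 2 * derivX 1 β θ * θ.u 0, -entryB β θ]

variable {𝕜 : Type*} [RCLike 𝕜] {Ω : Set (ℝ × ℝ)} {β : ℝ → ℝ → ℝ} {U : Set Jet}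

theorem matrixSmoothOn_matrixA (hΩ : IsOpen Ω) (hU : U ⊆ regularRegion Ω) :
    MatrixSmoothOn (matrixA 𝕜) U := by
  have hu : ContDiffOn ℝ ∞ (fun y : ℝ × ℝ × (Fin 2 → ℝ) => 1 / y.2.2 0)
      {y | (y.1, y.2.1) ∈ Ω ∧ y.2.2 0 ≠ 0} :=
    contDiffOn_const.div (by fun_prop) fun y hy => hy.2
  intro i j
  fin_cases i <;> fin_cases j
  · exact smoothOn_ofReal 𝕜 hΩ hU _ hu fun η => rfl
  · exact smoothOn_ofReal 𝕜 hΩ hU (fun _ => 1) contDiffOn_const fun η => rfl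
  · exact smoothOn_ofReal 𝕜 hΩ hU (fun _ => 1) contDiffOn_const fun η => rfl
  · exact smoothOn_ofReal 𝕜 hΩ hU _ hu.neg fun η => rfl

theorem matrixSmoothOn_matrixB (hΩ : IsOpen Ω)
    (hβ : ContDiffOn ℝ ∞ (fun q : ℝ × ℝ => β q.1 q.2) Ω) (hU : U ⊆ regularRegion Ω) :
    MatrixSmoothOn (matrixB 𝕜 β) U := by
  set W : Set (ℝ × ℝ × (Fin 2 → ℝ)) := {y | (y.1, y.2.1) ∈ Ω ∧ y.2.2 0 ≠ 0} with hW
  have hb : ∀ k, ContDiffOn ℝ ∞ (fun y : ℝ × ℝ × (Fin 2 → ℝ) => iteratedDeriv k (β y.1) y.2.1) W :=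
    fun k => (contDiffOn_iteratedDeriv hΩ hβ k).comp (f := fun y : ℝ × ℝ × (Fin 2 → ℝ) => (y.1, y.2.1))
      (by fun_prop) fun y hy => hy.1
  have hb0 : ContDiffOn ℝ ∞ (fun y : ℝ × ℝ × (Fin 2 → ℝ) => β y.1 y.2.1) W := by
    simpa only [iteratedDeriv_zero] using hb 0
  have hu : ∀ i, ContDiffOn ℝ ∞ (fun y : ℝ × ℝ × (Fin 2 → ℝ) => y.2.2 i) W := fun i => by fun_prop
  have h00 : ContDiffOn ℝ ∞ (fun y : ℝ × ℝ × (Fin 2 → ℝ) =>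
      -iteratedDeriv 1 (β y.1) y.2.1 * y.2.2 1 + 4 * (β y.1 y.2.1 / y.2.2 0)
        - iteratedDeriv 2 (β y.1) y.2.1 * y.2.2 0) W :=
    (((hb 1).neg.mul (hu 1)).add (contDiffOn_const.mul (hb0.div (hu 0) fun y hy => hy.2))).sub
      ((hb 2).mul (hu 0))
  have hm : ContDiffOn ℝ ∞ (fun y : ℝ × ℝ × (Fin 2 → ℝ) =>
      2 * iteratedDeriv 1 (β y.1) y.2.1 * y.2.2 0) W :=
    (contDiffOn_const.mul (hb 1)).mul (hu 0)
  have h4 : ContDiffOn ℝ ∞ (fun y : ℝ × ℝ × (Fin 2 → ℝ) => 4 * β y.1 y.2.1) W :=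
    contDiffOn_const.mul hb0
  intro i j
  fin_cases i <;> fin_cases j
  · exact smoothOn_ofReal 𝕜 hΩ hU _ h00 fun η => rfl
  · exact smoothOn_ofReal 𝕜 hΩ hU _ (h4.add hm) fun η => rfl
  · exact smoothOn_ofReal 𝕜 hΩ hU _ (h4.sub hm) fun η => rfl
  · exact smoothOn_ofReal 𝕜 hΩ hU _ h00.neg fun η => rfl

theorem zero_curvature_matrixA_matrixB (hΩ : IsOpen Ω)
    (hβ : ContDiffOn ℝ ∞ (fun q : ℝ × ℝ => β q.1 q.2) Ω) (hU : U ⊆ regularRegion Ω) {θ : Jet}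
    (hθ : θ ∈ U) :
    matrixTotalT (evolutionRHS β) (matrixA 𝕜) θ - matrixTotalX (matrixB 𝕜 β) θ +
      (matrixA 𝕜 θ * matrixB 𝕜 β θ - matrixB 𝕜 β θ * matrixA 𝕜 θ) = 0 := by
  have hq : (θ.t, θ.x) ∈ Ω := (hU hθ).1
  have hu : θ.u 0 ≠ 0 := (hU hθ).2
  have hsA := matrixSmoothOn_matrixA (𝕜 := 𝕜) hΩ hU
  have hsB := matrixSmoothOn_matrixB (𝕜 := 𝕜) hΩ hβ hU
  have hdT : HasDerivAt (fun s : ℝ => 1 / (θ.u 0 + s * evolutionRHS β θ))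
      (-evolutionRHS β θ / θ.u 0 ^ 2) 0 := by
    have := (((hasDerivAt_id (0 : ℝ)).mul_const (evolutionRHS β θ)).const_add (θ.u 0)).inv
      (by simpa using hu)
    simp only [one_div]
    exact this.congr_deriv (by simp)
  have hdu : ∀ k, HasDerivAt (fun s : ℝ => θ.u k + s * θ.u (k + 1)) (θ.u (k + 1)) 0 := fun k => by
    simpa using ((hasDerivAt_id (0 : ℝ)).mul_const (θ.u (k + 1))).const_add (θ.u k)
  have hdb : ∀ k, HasDerivAt (fun s : ℝ => iteratedDeriv k (β θ.t) (θ.x + s))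
      (derivX (k + 1) β θ) 0 := fun k => hasDerivAt_iteratedDeriv hΩ hβ k hq
  have hdb0 : HasDerivAt (fun s : ℝ => β θ.t (θ.x + s)) (derivX 1 β θ) 0 := by
    simpa only [iteratedDeriv_zero] using hdb 0
  have hdb1 : HasDerivAt (fun s : ℝ => 2 * iteratedDeriv 1 (β θ.t) (θ.x + s) * (θ.u 0 + s * θ.u 1))
      (2 * derivX 2 β θ * θ.u 0 + 2 * derivX 1 β θ * θ.u 1) 0 := by
    exact (((hdb 1).const_mul 2).mul (hdu 0)).congr_deriv (by simp [derivX])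
  have hd4 := hdb0.const_mul 4
  have hd00 : HasDerivAt (fun s : ℝ => -iteratedDeriv 1 (β θ.t) (θ.x + s) * (θ.u 1 + s * θ.u 2) +
      4 * (β θ.t (θ.x + s) / (θ.u 0 + s * θ.u 1)) -
        iteratedDeriv 2 (β θ.t) (θ.x + s) * (θ.u 0 + s * θ.u 1))
      (-derivX 2 β θ * θ.u 1 - derivX 1 β θ * θ.u 2 +
        4 * ((derivX 1 β θ * θ.u 0 - β θ.t θ.x * θ.u 1) / θ.u 0 ^ 2) -
        (derivX 3 β θ * θ.u 0 + derivX 2 β θ * θ.u 1)) 0 := by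
    have := (((hdb 1).neg.mul (hdu 1)).add ((hdb0.div (hdu 0) (by simpa using hu)).const_mul 4)).sub
      ((hdb 2).mul (hdu 0))
    refine this.congr_deriv ?_
    simp [derivX]
    ring
  have hT00 : totalT (evolutionRHS β) (fun η => matrixA 𝕜 η 0 0) θ = _ :=
    totalT_ofReal_eq _ (f := fun η => realA η 0 0) (hsA 0 0) hθ hdT
  have hT01 : totalT (evolutionRHS β) (fun η => matrixA 𝕜 η 0 1) θ = _ :=
    totalT_ofReal_eq _ (f := fun η => realA η 0 1) (hsA 0 1) hθ (hasDerivAt_const 0 1)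
  have hT10 : totalT (evolutionRHS β) (fun η => matrixA 𝕜 η 1 0) θ = _ :=
    totalT_ofReal_eq _ (f := fun η => realA η 1 0) (hsA 1 0) hθ (hasDerivAt_const 0 1)
  have hT11 : totalT (evolutionRHS β) (fun η => matrixA 𝕜 η 1 1) θ = _ :=
    totalT_ofReal_eq _ (f := fun η => realA η 1 1) (hsA 1 1) hθ hdT.neg
  have hX00 : totalX (fun η => matrixB 𝕜 β η 0 0) θ = _ :=
    totalX_ofReal_eq (f := fun η => realB β η 0 0) (hsB 0 0) hθ hd00
  have hX01 : totalX (fun η => matrixB 𝕜 β η 0 1) θ = _ :=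
    totalX_ofReal_eq (f := fun η => realB β η 0 1) (hsB 0 1) hθ (hd4.add hdb1)
  have hX10 : totalX (fun η => matrixB 𝕜 β η 1 0) θ = _ :=
    totalX_ofReal_eq (f := fun η => realB β η 1 0) (hsB 1 0) hθ (hd4.sub hdb1)
  have hX11 : totalX (fun η => matrixB 𝕜 β η 1 1) θ = _ :=
    totalX_ofReal_eq (f := fun η => realB β η 1 1) (hsB 1 1) hθ hd00.neg
  have hA : matrixA 𝕜 θ = (realA θ).map (fun r : ℝ => (r : 𝕜)) := rfl
  have hB : matrixB 𝕜 β θ = (realB β θ).map (fun r : ℝ => (r : 𝕜)) := rfl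
  ext i j
  -- Once the computed derivatives are inserted and the casts removed, each entry is a rational
  -- identity over `ℝ` with powers of `u` as denominators.
  fin_cases i <;> fin_cases j <;>
    simp only [Fin.zero_eta, Fin.mk_one, Fin.isValue, Matrix.add_apply, Matrix.sub_apply,
      Matrix.mul_apply, Fin.sum_univ_two, matrixTotalT, matrixTotalX, Matrix.of_apply, hT00, hT01, hT10,
      hT11, hX00, hX01, hX10, hX11, hA, hB, Matrix.map_apply, Matrix.zero_apply] <;>
    norm_cast <;>
    simp only [realA, realB, entryB, evolutionRHS, Matrix.of_apply, Matrix.cons_val', Matrix.cons_val_zero,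
      Matrix.cons_val_one, Matrix.cons_val_fin_one] <;>
    field_simp <;> ring

end Representation

end ZeroCurvature

end

/-! ### The main theorem -/

theorem mainTheorem3 {𝕜 : Type*} [RCLike 𝕜] (Ω : Set (ℝ × ℝ)) (hΩ : IsOpen Ω)
    (β : ℝ → ℝ → ℝ) (hβ : ContDiffOn ℝ ∞ (fun q : ℝ × ℝ => β q.1 q.2) Ω)
    (hβx : ∀ q ∈ Ω, deriv (β q.1) q.2 ≠ 0)
    (U : Set ZeroCurvature.Jet) (hU : IsOpen U) (hne : U.Nonempty)
    (hUΩ : U ⊆ ZeroCurvature.regularRegion Ω) :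
    ZeroCurvature.IrreducibleZCROn (ZeroCurvature.evolutionRHS β) U
        (ZeroCurvature.matrixA 𝕜) (ZeroCurvature.matrixB 𝕜 β) ∧
      ¬ ∃ A' B' : ZeroCurvature.Jet → Matrix (Fin 2) (Fin 2) 𝕜,
          ZeroCurvature.LowerTriangularOn U A' B' ∧
          ZeroCurvature.GaugeEquivOn (ZeroCurvature.evolutionRHS β) U
            (ZeroCurvature.matrixA 𝕜) (ZeroCurvature.matrixB 𝕜 β) A' B' := by
  have hu : ∀ θ ∈ U, θ.u 0 ≠ 0 := fun θ hθ => (hUΩ hθ).2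
  refine ⟨⟨⟨ZeroCurvature.matrixSmoothOn_matrixA hΩ hUΩ,
    ZeroCurvature.matrixSmoothOn_matrixB hΩ hβ hUΩ, fun θ _ => ZeroCurvature.matrixA_trace θ,
    fun θ _ => ?_, fun θ hθ => ZeroCurvature.zero_curvature_matrixA_matrixB hΩ hβ hUΩ hθ⟩, ?_⟩, ?_⟩
  · rw [ZeroCurvature.mem_sl₂_iff]
    simp [ZeroCurvature.matrixB, Matrix.trace_fin_two]
  · rintro ⟨𝔥, h𝔥, A', B', hZ, hg⟩
    obtain ⟨N, hN, htr, hst⟩ := ZeroCurvature.exists_stable_line h𝔥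
    exact ZeroCurvature.not_exists_stable_line hU hne hu hg hN htr
      fun θ hθ => hst _ (hZ.mem_A θ hθ)
  · rintro ⟨A', B', hlt, hg⟩
    -- For lower triangular `A'` one has `[E₂₁, A'] = (A'₁₁ - A'₂₂) E₂₁`, whatever the diagonal.
    refine ZeroCurvature.not_exists_stable_line hU hne hu hg (N := !![0, 0; 1, 0])
      (fun h => one_ne_zero (congrFun (congrFun h 1) 0)) (by simp [Matrix.trace_fin_two])
      fun θ hθ => ⟨A' θ 0 0 - A' θ 1 1, ?_⟩
    have h01 := (hlt θ hθ).1
    ext i j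
    fin_cases i <;> fin_cases j <;> simp [Matrix.vecMul, dotProduct, Matrix.mul_apply, h01]
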